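/- Let $R$ be a (not necessarily commutative) ring and let $\mathcal C$ be a class of left $R$-modules which is closed under finite direct sums (including the zero module), direct summands and isomorphisms. Let $\mathcal V(\mathcal C)$ be the additive commutative semigroup of isomorphism classes $[M]$ of modules $M$ in $\mathcal C$, with $[M]+[N]=[M\oplus N]$ and identity $[0]$. For a non-zero $a\in\mathcal V(\mathcal C)$ let $\mathsf L(a)$ be the set of all $k\in\mathbb N=\{1,2,\dots\}$ such that $a=u_1+\dots+u_k$ for some atoms (irreducible elements) $u_1,\dots,u_k$ of $\mathcal V(\mathcal C)$, let $\mathsf L(0)=\{0\}$, and let $\mathscr L(\mathcal V(\mathcal C))=\{\mathsf L(a): a\in\mathcal V(\mathcal C)\}$. For $k\in\mathbb N$ let $\mathscr U_k$ be the union of all $L\in\mathscr L(\mathcal V(\mathcal C))$ with $k\in L$. Suppose that 1. every $M$ in $\mathcal C$ is directly finite, that is, $M\cong M\oplus N$ implies $N=0$; 2. up to isomorphism, there are only finitely many indecomposable modules in $\mathcal C$, and there is at least one. Then $\mathscr L(\mathcal V(\mathcal C))$ satisfies the Structure Theorem for Unions: there are $d\in\mathbb N$ and $M\in\mathbb N_0$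 such that, for all sufficiently large $k$, the set $\mathscr U_k$ is an almost arithmetical progression with difference $d$ and bound $M$. That is, $\mathscr U_k\subseteq y+d\mathbb Z$ for some $y\in\mathbb Z$, and $\mathscr U_k\cap[\inf\mathscr U_k+M,\ \sup\mathscr U_k-M]$ is an arithmetical progression with difference $d$, meaning that it is non-empty and any two of its successive elements differ by exactly $d$. -/

import Mathlib

universe u v

namespace UnionsOfLengths

/-! ### Families of subsets of the non-negative integers -/

/-- The set `Δ(L)` of distances of `L ⊆ ℕ`: the differences of successive elements of `L`. -/
def distances (L : Set ℕ) : Set ℕ :=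
  {d | 0 < d ∧ ∃ k ∈ L, k + d ∈ L ∧ ∀ m ∈ L, ¬(k < m ∧ m < k + d)}

/-- `L` is a (finite or infinite) arithmetical progression with difference `d`: it is non-empty
and has no distance other than `d`. One-point sets are progressions with every difference. -/
def IsAP (d : ℕ) (L : Set ℕ) : Prop :=
  L.Nonempty ∧ distances L ⊆ {d}

/-- The central part `L ∩ ⟦inf L + M, sup L - M⟧`; the supremum is taken in `ℕ∞`, and the
condition `n ≤ sup L - M` is written as `n + M ≤ sup L`. -/
def centralPart (M : ℕ) (L : Set ℕ) : Set ℕ :=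
  {n ∈ L | sInf L + M ≤ n ∧ ((n + M : ℕ) : ℕ∞) ≤ ⨆ m ∈ L, (m : ℕ∞)}

/-- `L` is an almost arithmetical progression (AAP) with difference `d` and bound `M`. -/
def IsAAP (d M : ℕ) (L : Set ℕ) : Prop :=
  (∃ y : ℤ, ∀ n ∈ L, ∃ z : ℤ, (n : ℤ) = y + d * z) ∧ IsAP d (centralPart M L)

/-- `𝒰ₖ(ℒ)`: the union of all members of the family `ℒ` that contain `k`. -/
def unionOfLengths (ℒ : Set (Set ℕ)) (k : ℕ) : Set ℕ :=
  ⋃₀ {L ∈ ℒ | k ∈ L}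

/-- The family `ℒ` satisfies the Structure Theorem for Unions. -/
def SatisfiesStructureTheoremForUnions (ℒ : Set (Set ℕ)) : Prop :=
  ∃ d : ℕ, 0 < d ∧ ∃ M : ℕ, ∃ k₀ : ℕ, ∀ k ≥ k₀, IsAAP d M (unionOfLengths ℒ k)

/-! ### Sets of lengths in an additively written commutative semigroup with identity -/

/-- The set of lengths `L(a)`: it is `{0}` if `a` is a unit, and otherwise it is the set of all
positive `k` such that `a` is a sum of `k` atoms. -/
def setOfLengths {H : Type*} [AddCommMonoid H] (a : H) : Set ℕ :=
  {k | (IsAddUnit a ∧ k = 0) ∨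
    (¬IsAddUnit a ∧ 0 < k ∧
      ∃ s : Multiset H, s.card = k ∧ (∀ p ∈ s, AddIrreducible p) ∧ s.sum = a)}

/-- The system `ℒ(H)` of sets of lengths. -/
def systemOfSetsOfLengths (H : Type*) [AddCommMonoid H] : Set (Set ℕ) :=
  Set.range (fun a : H => setOfLengths a)

/-! ### Classes of modules and their semigroups of isomorphism classes -/

section Modules

variable {R : Type u} [Ring R]

/-- A class `C` of left `R`-modules is closed under finite direct sums (the empty sum included),
direct summands and isomorphisms. -/
class ClosedUnderSumsAndSummands (C : ModuleCat.{v} R → Prop) : Prop where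
  of_equiv : ∀ M N : ModuleCat.{v} R, Nonempty (M ≃ₗ[R] N) → C M → C N
  zero : C (ModuleCat.of R PUnit.{v + 1})
  sum : ∀ M N : ModuleCat.{v} R, C M → C N → C (ModuleCat.of R (M × N))
  summand : ∀ M N : ModuleCat.{v} R, C (ModuleCat.of R (M × N)) → C M ∧ C N

/-- `M` is directly finite: `M ≅ M ⊕ N` only for `N = 0`. -/
def DirectlyFinite (M : ModuleCat.{v} R) : Prop :=
  ∀ N : ModuleCat.{v} R, Nonempty (M ≃ₗ[R] M × N) → Subsingleton N

/-- `M` is indecomposable: `M ≠ 0`, and `M ≅ N ⊕ P` implies `N = 0` or `P = 0`. -/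
def Indecomposable (M : ModuleCat.{v} R) : Prop :=
  Nontrivial M ∧
    ∀ N P : ModuleCat.{v} R, Nonempty (M ≃ₗ[R] N × P) → Subsingleton N ∨ Subsingleton P

/-- Isomorphism of modules, as an equivalence relation on the class `C`. -/
def isoSetoid (C : ModuleCat.{v} R → Prop) : Setoid {M : ModuleCat.{v} R // C M} where
  r M N := Nonempty (M.1 ≃ₗ[R] N.1)
  iseqv :=
    { refl := fun _ => ⟨LinearEquiv.refl R _⟩
      symm := fun ⟨e⟩ => ⟨e.symm⟩
      trans := fun ⟨e⟩ ⟨f⟩ => ⟨e.trans f⟩ }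

/-- `𝒱(C)`: the isomorphism classes of modules in `C`. -/
def IsoClasses (C : ModuleCat.{v} R → Prop) : Type (max u (v + 1)) :=
  Quotient (isoSetoid C)

/-- The zero of `𝒱(C)` is the class of the zero module. -/
instance (C : ModuleCat.{v} R → Prop) [hC : ClosedUnderSumsAndSummands C] :
    Zero (IsoClasses C) where
  zero := Quotient.mk (isoSetoid C) ⟨ModuleCat.of R PUnit.{v + 1}, hC.zero⟩

/-- Addition on `𝒱(C)`: `[M] + [N] = [M ⊕ N]`. -/
instance (C : ModuleCat.{v} R → Prop) [hC : ClosedUnderSumsAndSummands C] :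
    Add (IsoClasses C) where
  add := Quotient.map₂ (sa := isoSetoid C) (sb := isoSetoid C) (sc := isoSetoid C)
    (fun M N => ⟨ModuleCat.of R (M.1 × N.1), hC.sum _ _ M.2 N.2⟩)
    (fun _ _ ⟨e⟩ _ _ ⟨f⟩ => ⟨e.prodCongr f⟩)

/-- `𝒱(C)` is a commutative semigroup with identity. -/
instance (C : ModuleCat.{v} R → Prop) [ClosedUnderSumsAndSummands C] :
    AddCommMonoid (IsoClasses C) where
  add_assoc := by
    rintro ⟨M⟩ ⟨N⟩ ⟨P⟩
    exact Quotient.sound (s := isoSetoid C) ⟨LinearEquiv.prodAssoc R M.1 N.1 P.1⟩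
  zero_add := by
    rintro ⟨M⟩
    exact Quotient.sound (s := isoSetoid C) ⟨LinearEquiv.uniqueProd⟩
  add_zero := by
    rintro ⟨M⟩
    exact Quotient.sound (s := isoSetoid C) ⟨LinearEquiv.prodUnique⟩
  add_comm := by
    rintro ⟨M⟩ ⟨N⟩
    exact Quotient.sound (s := isoSetoid C) ⟨LinearEquiv.prodComm R M.1 N.1⟩
  nsmul := nsmulRec

end Modules

end UnionsOfLengths

/-! Direct finiteness makes `IsoClasses C` unit-cancellative, and it has finitely many atoms. The
pairs of lengths of two factorizations of one element form a symmetric submonoid `P` of `ℕ × ℕ`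
containing the diagonal, and `𝒰ₖ` is its fibre over `k`. As cancellation may fail, the congruence of
pairs with equal value need not be finitely generated. Its enlargement `cancellativeKernel` is
subtractive, hence finitely generated by Dickson's lemma. Unit-cancellativity bounds the length
ratios there, so a generator attains the largest one, `q / p`; adding a fixed `u` to its multiples
brings them back into the congruence. Hence `P` lies in a cone of slope `q / p` and contains a
translated ray of that slope (`exists_slope_lengthPairs`). The ray, the diagonal and one pair of
minimal difference `d` generate every admissible point of the cone outside a strip of bounded width
along its edges. -/

namespace UnionsOfLengths

/-! ### Submonoids of `ℕ × ℕ` -/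

/-- The differences `n - k` of the pairs `(k, n)` in a symmetric submonoid of `ℕ × ℕ` form a
cyclic group, whose non-negative generator is itself such a difference. -/
theorem exists_generator_of_differences (P : AddSubmonoid (ℕ × ℕ))
    (hsymm : ∀ k n, (k, n) ∈ P → (n, k) ∈ P) :
    ∃ d m : ℕ, (m, m + d) ∈ P ∧ ∀ k n, (k, n) ∈ P → (d : ℤ) ∣ (n : ℤ) - k := by
  let D : AddSubgroup ℤ :=
    { carrier := {z | ∃ k n, (k, n) ∈ P ∧ z = (n : ℤ) - k}
      zero_mem' := ⟨0, 0, P.zero_mem, by simp⟩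
      add_mem' := by
        rintro _ _ ⟨k, n, h, rfl⟩ ⟨k', n', h', rfl⟩
        exact ⟨k + k', n + n', P.add_mem h h', by push_cast; ring⟩
      neg_mem' := by
        rintro _ ⟨k, n, h, rfl⟩
        exact ⟨n, k, hsymm _ _ h, by ring⟩ }
  obtain ⟨a, ha⟩ := Int.subgroup_cyclic D
  have hmem : ((a.natAbs : ℕ) : ℤ) ∈ D := by
    have haD : a ∈ D := ha ▸ AddSubgroup.subset_closure rfl
    rcases Int.natAbs_eq a with h | h
    · rwa [← h]
    · rw [show ((a.natAbs : ℕ) : ℤ) = -a by omega]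
      exact D.neg_mem haD
  obtain ⟨k, n, hkn, h⟩ := hmem
  refine ⟨a.natAbs, k, ?_, fun k n hkn => ?_⟩
  · rwa [show k + a.natAbs = n by omega]
  · have : (n : ℤ) - k ∈ D := ⟨k, n, hkn, rfl⟩
    rw [ha, AddSubgroup.mem_closure_singleton] at this
    obtain ⟨z, hz⟩ := this
    rw [Int.natAbs_dvd]
    exact ⟨z, by rw [← hz, smul_eq_mul, mul_comm]⟩

/-- A submonoid of `ℕ × ℕ` containing the diagonal, a pair with difference `d` and a ray of slope
`q / p` contains all pairs of difference divisible by `d` between the diagonal and a line of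
slope `q / p`. -/
theorem mem_of_le_of_dvd {P : AddSubmonoid (ℕ × ℕ)} (hdiag : (1, 1) ∈ P) {d m p q c : ℕ}
    (hd : 0 < d) (hp : 0 < p) (hpq : p < q) (hm : (m, m + d) ∈ P)
    (hray : ∀ N : ℕ, (c + N * p, c + N * q) ∈ P) (hdvd : d ∣ q - p) {k n : ℕ} (hkn : k ≤ n)
    (hdn : d ∣ n - k) (hn : p * n + p * ((c + q * m) * (q - p)) ≤ q * k) : (k, n) ∈ P := by
  obtain ⟨e, rfl⟩ := Nat.exists_eq_add_of_le hpq.le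
  simp only [Nat.add_sub_cancel_left] at hdvd hn
  obtain ⟨x, rfl⟩ := Nat.exists_eq_add_of_le hkn
  simp only [Nat.add_sub_cancel_left] at hdn
  have he : 0 < e := by omega
  -- The target is `(k, n) = (c + N * p, c + N * q) + j • (m, m + d) + r • (1, 1)`: division by `e =
  -- q - p` splits the difference `x` as `e * N + d * j`, and `r` fills up the first coordinate.
  set N := x / e
  have hx : e * N + x % e = x := Nat.div_add_mod x e
  have hr : x % e < e := Nat.mod_lt _ he
  obtain ⟨j, hj⟩ : d ∣ x % e := (Nat.dvd_mod_iff hdvd).2 hdn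
  have hje : j ≤ p + e := by nlinarith
  have hk : c + N * p + j * m ≤ k := by
    have h1 : e * (p * N + p * (c + (p + e) * m)) ≤ e * k := by
      have h0 : p * (e * N) ≤ p * x := Nat.mul_le_mul_left p (by omega)
      linarith
    have h2 := Nat.le_of_mul_le_mul_left h1 he
    have h3 : j * m ≤ (p + e) * m := Nat.mul_le_mul_right m hje
    have h4 : c + (p + e) * m ≤ p * (c + (p + e) * m) := Nat.le_mul_of_pos_left _ hp
    linarith [mul_comm N p]
  obtain ⟨r, rfl⟩ := Nat.exists_eq_add_of_le hk
  have key := P.add_mem (P.add_mem (hray N) (P.nsmul_mem hm j)) (P.nsmul_mem hdiag r)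
  convert key using 1
  simp only [Prod.smul_mk, Prod.mk_add_mk, smul_eq_mul, mul_one, Prod.mk.injEq, true_and]
  rw [← hx, hj]
  ring

/-- If a symmetric submonoid `P` of `ℕ × ℕ` contains the diagonal, lies below the line of slope
`q / p`, and contains a translate of the ray spanned by `(p, q)`, then the sets `{n | (k, n) ∈ P}` are, for large `k`, almost arithmetical progressions
with uniform difference and bound. -/
theorem exists_isAAP_of_addSubmonoid (P : AddSubmonoid (ℕ × ℕ)) (hdiag : (1, 1) ∈ P)
    (hsymm : ∀ k n, (k, n) ∈ P → (n, k) ∈ P) {p q c : ℕ} (hp : 0 < p)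
    (hslope : ∀ k n, (k, n) ∈ P → p * n ≤ q * k)
    (hray : ∀ N : ℕ, (c + N * p, c + N * q) ∈ P) :
    ∃ d : ℕ, 0 < d ∧ ∃ M : ℕ, ∃ k₀ : ℕ, ∀ k ≥ k₀, IsAAP d M {n | (k, n) ∈ P} := by
  have hrefl (k : ℕ) : (k, k) ∈ P := by simpa using P.nsmul_mem hdiag k
  obtain ⟨d, m, hm, hdvd⟩ := exists_generator_of_differences P hsymm
  rcases Nat.eq_zero_or_pos d with rfl | hd
  -- All differences vanish, so `P` is the diagonal; any positive difference serves, here 1.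
  · have hset (k : ℕ) : {n | (k, n) ∈ P} = {k} := by
      ext n
      refine ⟨fun h => ?_, fun h => ?_⟩
      · have := hdvd k n h
        simp only [Nat.cast_zero, zero_dvd_iff] at this
        exact Set.mem_singleton_iff.2 (by omega)
      · rw [Set.mem_singleton_iff.1 h]; exact hrefl k
    refine ⟨1, one_pos, 0, 0, fun k _ => ?_⟩
    rw [hset]
    refine ⟨⟨0, fun n _ => ⟨n, by simp⟩⟩, ⟨k, by simp [centralPart]⟩, ?_⟩
    rintro x ⟨hx, a, ha, hb, -⟩
    have h1 : a = k := ha.1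
    have h2 : a + x = k := hb.1
    omega
  have hpq : p < q := by
    have h1 := hslope _ _ hm
    by_contra hle
    have h2 : q * m ≤ p * m := Nat.mul_le_mul_right m (not_lt.1 hle)
    have h3 : 0 < p * d := Nat.mul_pos hp hd
    rw [mul_add] at h1
    omega
  have hdpq : d ∣ q - p := by
    have h := hdvd _ _ (hray 1)
    rw [← Int.natCast_dvd_natCast, Nat.cast_sub hpq.le]
    convert h using 1
    push_cast
    ring
  set M := (c + q * m) * (q - p) with hM
  -- Cutting `M` off both ends of a fibre lands in the cone shrunk by `M`, where `hmem` shows that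
  -- divisibility by `d` is the only obstruction.
  have hcentral {k n : ℕ} (h : n ∈ centralPart M {n | (k, n) ∈ P}) :
      p * n + p * M ≤ q * k ∧ p * k + p * M ≤ q * n := by
    obtain ⟨-, h1, h2⟩ := h
    constructor
    · obtain ⟨x, hx, hle⟩ : ∃ x ∈ {n | (k, n) ∈ P}, n + M ≤ x := by
        by_contra! hlt
        have h3 : (⨆ x ∈ {n | (k, n) ∈ P}, (x : ℕ∞)) ≤ ((n + M - 1 : ℕ) : ℕ∞) :=
          iSup₂_le fun x hx => by
            have := hlt x hx
            exact_mod_cast (by omega : x ≤ n + M - 1)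
        have h4 : n + M ≤ n + M - 1 := by exact_mod_cast h2.trans h3
        -- This gives `0 < n + M`, so the subtraction in `n + M - 1` is not truncated.
        have := hlt k (hrefl k)
        omega
      calc p * n + p * M = p * (n + M) := by ring
        _ ≤ p * x := Nat.mul_le_mul_left p hle
        _ ≤ q * k := hslope _ _ hx
    · have hy : (k, sInf {n | (k, n) ∈ P}) ∈ P :=
        Nat.sInf_mem (s := {n | (k, n) ∈ P}) ⟨k, hrefl k⟩
      calc p * k + p * M ≤ q * sInf {n | (k, n) ∈ P} + q * M :=
            add_le_add (hslope _ _ (hsymm _ _ hy)) (Nat.mul_le_mul_right M hpq.le)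
        _ = q * (sInf {n | (k, n) ∈ P} + M) := by ring
        _ ≤ q * n := Nat.mul_le_mul_left q h1
  have hmem {k n : ℕ} (hdn : (d : ℤ) ∣ (n : ℤ) - k)
      (h : p * n + p * M ≤ q * k ∧ p * k + p * M ≤ q * n) : (k, n) ∈ P := by
    rcases le_total k n with hkn | hkn
    · exact mem_of_le_of_dvd hdiag hd hp hpq hm hray hdpq hkn
        (by rw [← Int.natCast_dvd_natCast, Nat.cast_sub hkn]; exact hdn) h.1
    · exact hsymm _ _ <| mem_of_le_of_dvd hdiag hd hp hpq hm hray hdpq hkn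
        (by rw [← Int.natCast_dvd_natCast, Nat.cast_sub hkn]; exact (dvd_sub_comm).1 hdn) h.2
  -- From this threshold on, `M` copies of `(m, m + d)` or of its mirror image fit below `k`, so the
  -- fibre contains `k ± M * d` and `k` is central.
  refine ⟨d, hd, M, M * (m + d), fun k hk => ⟨⟨k, fun n hn => ?_⟩, ⟨k, ?_⟩, ?_⟩⟩
  · obtain ⟨z, hz⟩ := hdvd _ _ hn
    exact ⟨z, by omega⟩
  · obtain ⟨r, hr⟩ := Nat.exists_eq_add_of_le hk
    have hMd : M ≤ M * d := Nat.le_mul_of_pos_right M hd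
    have hup : (k, k + M * d) ∈ P := by
      convert P.add_mem (P.nsmul_mem hm M) (hrefl (M * d + r)) using 1
      simp only [Prod.smul_mk, Prod.mk_add_mk, smul_eq_mul, Prod.mk.injEq]
      constructor <;> rw [hr] <;> ring
    have hdown : (k, k - M * d) ∈ P := by
      convert P.add_mem (P.nsmul_mem (hsymm _ _ hm) M) (hrefl r) using 1
      simp only [Prod.smul_mk, Prod.mk_add_mk, smul_eq_mul, Prod.mk.injEq]
      refine ⟨hr, ?_⟩
      rw [hr, mul_add]
      omega
    refine ⟨hrefl k, ?_, ?_⟩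
    · have h1 : sInf {n | (k, n) ∈ P} ≤ k - M * d := Nat.sInf_le hdown
      have h2 : M * d ≤ k := by rw [hr, mul_add]; omega
      omega
    · exact le_trans (by exact_mod_cast Nat.add_le_add_left hMd k)
        (le_iSup₂ (f := fun (x : ℕ) (_ : x ∈ {n | (k, n) ∈ P}) => (x : ℕ∞)) (k + M * d) hup)
  · rintro x ⟨hx, a, ha, hb, hgap⟩
    rw [Set.mem_singleton_iff]
    have hda := hdvd _ _ ha.1
    have hdx : d ∣ x := by
      have h := dvd_sub (hdvd _ _ hb.1) hda
      rwa [sub_sub_sub_cancel_right, Nat.cast_add, add_sub_cancel_left,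
        Int.natCast_dvd_natCast] at h
    by_contra hne
    have hlt : d < x := lt_of_le_of_ne (Nat.le_of_dvd hx hdx) (Ne.symm hne)
    have hca := hcentral ha
    have hcb := hcentral hb
    -- The shrunken cone meets each fibre in an interval, so it contains `a + d` along with `a` and
    -- `a + x`.
    refine hgap (a + d) ⟨?_, ?_, ?_⟩ ⟨by omega, by omega⟩
    · refine hmem ?_ ⟨?_, ?_⟩
      · rw [Nat.cast_add, add_sub_right_comm]
        exact dvd_add hda (dvd_refl (d : ℤ))
      · have : p * (a + d) ≤ p * (a + x) := Nat.mul_le_mul_left p (by omega)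
        omega
      · have : q * a ≤ q * (a + d) := Nat.mul_le_mul_left q (by omega)
        omega
    · have := ha.2.1
      omega
    · exact le_trans (by exact_mod_cast (by omega : a + d + M ≤ a + x + M)) hb.2.2

/-! ### Congruences without proper absorption -/

section Congruence

variable {F H : Type*} [AddCommMonoid F] [AddCommMonoid H]

/-- The pairs of elements of `F` whose images under `f` agree after adding the image of some
common element: the kernel of the map from `F` to the cancellative quotient of its image. -/
def cancellativeKernel (f : F →+ H) : AddSubmonoid (F × F) where
  carrier := {x | ∃ u, f (x.1 + u) = f (x.2 + u)}
  zero_mem' := ⟨0, rfl⟩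
  add_mem' := by
    rintro ⟨s, t⟩ ⟨s', t'⟩ ⟨u, h⟩ ⟨u', h'⟩
    refine ⟨u + u', ?_⟩
    simp only [Prod.mk_add_mk, map_add] at h h' ⊢
    rw [add_add_add_comm, h, h', add_add_add_comm]

/-- The common summand `u` absorbs the failure of cancellation in `H`; this is what makes the kernel
finitely generated. -/
theorem cancellativeKernel_subtractive (f : F →+ H) :
    ∀ x ∈ cancellativeKernel f, ∀ y, x + y ∈ cancellativeKernel f →
      y ∈ cancellativeKernel f := by
  rintro ⟨s, t⟩ ⟨u, h⟩ ⟨s', t'⟩ ⟨v, h'⟩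
  refine ⟨s + u + v, ?_⟩
  simp only [Prod.mk_add_mk, map_add] at h h' ⊢
  calc f s' + (f s + f u + f v) = (f s + f s' + f v) + f u := by abel
    _ = (f t + f u) + (f t' + f v) := by rw [h']; abel
    _ = f t' + (f s + f u + f v) := by rw [← h]; abel

/-- The lengths of pairs of elements of `F` with the same image under `f`. -/
def lengthPairs (f : F →+ H) (l : F →+ ℕ) : AddSubmonoid (ℕ × ℕ) where
  carrier := {x | ∃ s t, f s = f t ∧ l s = x.1 ∧ l t = x.2}
  zero_mem' := ⟨0, 0, rfl, map_zero l, map_zero l⟩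
  add_mem' := by
    rintro x y ⟨s, t, h, hs, ht⟩ ⟨s', t', h', hs', ht'⟩
    exact ⟨s + s', t + t', by simp [h, h'], by simp [hs, hs'], by simp [ht, ht']⟩

/-- If no element of `F` has the same value under `f` as a proper multiple of it, then the pairs
of lengths lie below a line of slope `q / p` and contain a translate of the ray spanned by
`(p, q)`. -/
theorem exists_slope_lengthPairs [PartialOrder F] [WellQuasiOrderedLE F]
    [IsOrderedCancelAddMonoid F] [CanonicallyOrderedAdd F] (f : F →+ H) (l : F →+ ℕ)
    (hl : ∀ s, l s = 0 → s = 0) (hf : ∀ s t, f (s + t) = f s → t = 0) (hone : ∃ s, l s = 1) :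
    ∃ p q c : ℕ, 0 < p ∧ (∀ k n, (k, n) ∈ lengthPairs f l → p * n ≤ q * k) ∧
      ∀ N : ℕ, (c + N * p, c + N * q) ∈ lengthPairs f l := by
  obtain ⟨G, hG⟩ := AddSubmonoid.fg_of_subtractive (cancellativeKernel_subtractive f)
  -- A pair `(0, t)` in the kernel means `f u = f (u + t)`, which forces `t = 0`; so ratios of
  -- lengths have nonzero denominators.
  have hpos : ∀ x ∈ cancellativeKernel f, l x.1 = 0 → x = 0 := by
    rintro ⟨s, t⟩ ⟨u, h⟩ h0
    obtain rfl := hl s h0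
    obtain rfl : t = 0 := hf u t (by simpa [add_comm] using h.symm)
    rfl
  have hGK : ∀ x ∈ G, x ∈ cancellativeKernel f := fun x hx =>
    hG ▸ AddSubmonoid.subset_closure hx
  classical
  let G' := G.filter (fun x => l x.1 ≠ 0)
  have hG' : G'.Nonempty := by
    by_contra hempty
    obtain ⟨s, hs⟩ := hone
    have hbot : cancellativeKernel f ≤ ⊥ := by
      rw [← hG, AddSubmonoid.closure_le]
      intro x hx
      refine hpos x (hGK x hx) ?_
      by_contra h
      exact hempty ⟨x, Finset.mem_filter.2 ⟨hx, h⟩⟩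
    have h := hbot (show (s, s) ∈ cancellativeKernel f from ⟨0, rfl⟩)
    simp only [AddSubmonoid.mem_bot, Prod.mk_eq_zero] at h
    simp [h.1] at hs
  obtain ⟨x, hx, hmax⟩ := G'.exists_max_image (fun x => (l x.2 : ℚ) / l x.1) hG'
  obtain ⟨hxG, hx0⟩ := Finset.mem_filter.1 hx
  have hxpos : 0 < l x.1 := Nat.pos_of_ne_zero hx0
  obtain ⟨u, hu⟩ := hGK x hxG
  refine ⟨l x.1, l x.2, l u, hxpos, ?_, fun N => ?_⟩
  · rintro _ _ ⟨s, t, h, rfl, rfl⟩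
    have hst : (s, t) ∈ AddSubmonoid.closure (G : Set (F × F)) := hG ▸ ⟨0, by simpa using h⟩
    suffices ∀ y ∈ AddSubmonoid.closure (G : Set (F × F)),
      l x.1 * l y.2 ≤ l x.2 * l y.1 from this _ hst
    intro y hy
    induction hy using AddSubmonoid.closure_induction with
    | mem y hy =>
      by_cases h0 : l y.1 = 0
      · simp [hpos y (hGK y hy) h0]
      · have h1 := hmax y (Finset.mem_filter.2 ⟨hy, h0⟩)
        have hypos : 0 < l y.1 := Nat.pos_of_ne_zero h0
        rw [div_le_div_iff₀ (by exact_mod_cast hypos) (by exact_mod_cast hxpos)] at h1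
        rw [mul_comm (l x.1)]
        exact_mod_cast h1
    | zero => simp
    | add y z _ _ hy hz =>
      simp only [Prod.fst_add, Prod.snd_add, map_add, mul_add]
      exact add_le_add hy hz
  -- One copy of `u` suffices for all `N`: it lets the copies of `x.1` be exchanged for `x.2` one at
  -- a time.
  · refine ⟨u + N • x.1, u + N • x.2, ?_, by simp, by simp⟩
    induction N with
    | zero => simp
    | succ N ih =>
      simp only [map_add, map_nsmul, succ_nsmul] at hu ih ⊢
      rw [← add_assoc, ih, ← add_assoc, add_right_comm, add_comm (f u), hu, add_comm (f x.2),
        add_right_comm]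

end Congruence

/-! ### Unit-cancellative semigroups with finitely many atoms -/

section Atoms

variable {H : Type*} [AddCommMonoid H]

/-- Dickson's lemma, carried over from finitely supported functions. -/
theorem wellQuasiOrderedLE_multiset (A : Type*) [Finite A] : WellQuasiOrderedLE (Multiset A) := by
  classical
  exact Monotone.wellQuasiOrderedLE_of_wellQuasiOrderedLE_of_surjective
    (Finsupp.orderIsoMultiset (ι := A)).monotone Finsupp.orderIsoMultiset.surjective

variable (H) in
/-- The factorization homomorphism: it sends a formal sum of atoms to its value. -/
def factorizationHom : Multiset {a : H // AddIrreducible a} →+ H :=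
  Multiset.sumAddMonoidHom.comp (Multiset.mapAddMonoidHom Subtype.val)

theorem factorizationHom_apply (s : Multiset {a : H // AddIrreducible a}) :
    factorizationHom H s = (s.map Subtype.val).sum := rfl

theorem eq_zero_of_isAddUnit_factorizationHom {s : Multiset {a : H // AddIrreducible a}}
    (h : IsAddUnit (factorizationHom H s)) : s = 0 := by
  induction s using Multiset.induction_on with
  | empty => rfl
  | cons a s _ =>
    rw [factorizationHom_apply, Multiset.map_cons, Multiset.sum_cons] at h
    exact absurd (isAddUnit_of_add_isAddUnit_left h) a.2.not_isAddUnit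

theorem mem_setOfLengths_iff {a : H} {k : ℕ} (hk : 0 < k) :
    k ∈ setOfLengths a ↔
      ∃ s : Multiset {a : H // AddIrreducible a}, s.card = k ∧ factorizationHom H s = a := by
  constructor
  · rintro (⟨-, rfl⟩ | ⟨-, -, s, hs, hirr, rfl⟩)
    · exact absurd hk (lt_irrefl 0)
    · lift s to Multiset {a : H // AddIrreducible a} using hirr
      exact ⟨s, by simpa using hs, rfl⟩
  · rintro ⟨s, hs, rfl⟩
    refine Or.inr ⟨fun h => ?_, hk, s.map Subtype.val, by simpa using hs, ?_, rfl⟩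
    · rw [eq_zero_of_isAddUnit_factorizationHom h, Multiset.card_zero] at hs
      omega
    · intro p hp
      obtain ⟨a, -, rfl⟩ := Multiset.mem_map.1 hp
      exact a.2

theorem unionOfLengths_eq {k : ℕ} (hk : 0 < k) :
    unionOfLengths (systemOfSetsOfLengths H) k =
      {n | (k, n) ∈ lengthPairs (factorizationHom H) Multiset.cardHom} := by
  ext n
  constructor
  · rintro ⟨_, ⟨⟨a, rfl⟩, hka⟩, hna⟩
    obtain ⟨s, hs, hsa⟩ := (mem_setOfLengths_iff hk).1 hka
    have hn : 0 < n := by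
      rcases hna with ⟨ha, -⟩ | ⟨-, hn, -⟩
      · rw [← hsa] at ha
        rw [eq_zero_of_isAddUnit_factorizationHom ha, Multiset.card_zero] at hs
        omega
      · exact hn
    obtain ⟨t, ht, hta⟩ := (mem_setOfLengths_iff hn).1 hna
    exact ⟨s, t, hsa.trans hta.symm, hs, ht⟩
  · rintro ⟨s, t, hst, hs, ht⟩
    simp only [Multiset.cardHom_apply] at hs ht
    have hn : 0 < n := by
      rw [Nat.pos_iff_ne_zero]
      rintro rfl
      obtain rfl := Multiset.card_eq_zero.1 ht
      rw [map_zero] at hst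
      rw [eq_zero_of_isAddUnit_factorizationHom (s := s) (by rw [hst]; exact isAddUnit_zero),
        Multiset.card_zero] at hs
      omega
    exact ⟨_, ⟨⟨factorizationHom H s, rfl⟩, (mem_setOfLengths_iff hk).2 ⟨s, hs, rfl⟩⟩,
      (mem_setOfLengths_iff hn).2 ⟨t, ht, hst.symm⟩⟩

/-- A unit-cancellative semigroup with finitely many atoms, and at least one, satisfies the
Structure Theorem for Unions. -/
theorem satisfiesStructureTheoremForUnions_of_finite_atoms
    (hcancel : ∀ a b : H, a + b = a → IsAddUnit b)
    (hfin : Finite {a : H // AddIrreducible a}) (hne : ∃ a : H, AddIrreducible a) :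
    SatisfiesStructureTheoremForUnions (systemOfSetsOfLengths H) := by
  obtain ⟨a, ha⟩ := hne
  have := wellQuasiOrderedLE_multiset {a : H // AddIrreducible a}
  obtain ⟨p, q, c, hp, hslope, hray⟩ :=
    exists_slope_lengthPairs (factorizationHom H) Multiset.cardHom
      (fun s hs => Multiset.card_eq_zero.1 hs)
      (fun s t h => eq_zero_of_isAddUnit_factorizationHom
        (hcancel (factorizationHom H s) _ (by rwa [← map_add])))
      ⟨{⟨a, ha⟩}, by simp⟩
  obtain ⟨d, hd, M, k₀, h⟩ := exists_isAAP_of_addSubmonoid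
    (lengthPairs (factorizationHom H) Multiset.cardHom)
    ⟨{⟨a, ha⟩}, {⟨a, ha⟩}, rfl, by simp, by simp⟩
    (fun k n ⟨s, t, hst, hs, ht⟩ => ⟨t, s, hst.symm, ht, hs⟩) hp hslope hray
  refine ⟨d, hd, M, k₀ + 1, fun k hk => ?_⟩
  rw [unionOfLengths_eq (by omega)]
  exact h k (by omega)

end Atoms

/-! ### Semigroups of isomorphism classes of modules -/

section IsoClasses

variable {R : Type u} [Ring R] {C : ModuleCat.{v} R → Prop}

/-- The class in `𝒱(C)` of a module in `C`. -/
def isoClass (M : ModuleCat.{v} R) (hM : C M) : IsoClasses C :=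
  Quotient.mk (isoSetoid C) ⟨M, hM⟩

theorem isoClass_eq_iff {M N : ModuleCat.{v} R} {hM : C M} {hN : C N} :
    isoClass M hM = isoClass N hN ↔ Nonempty (M ≃ₗ[R] N) :=
  Quotient.eq (r := isoSetoid C)

theorem exists_eq_isoClass (a : IsoClasses C) : ∃ M, ∃ hM : C M, a = isoClass M hM := by
  obtain ⟨⟨M, hM⟩, rfl⟩ := Quotient.exists_rep a
  exact ⟨M, hM, rfl⟩

variable [hC : ClosedUnderSumsAndSummands C]

theorem isoClass_add {M N : ModuleCat.{v} R} (hM : C M) (hN : C N) :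
    isoClass M hM + isoClass N hN = isoClass (ModuleCat.of R (M × N)) (hC.sum M N hM hN) := rfl

theorem isoClass_eq_zero_iff {M : ModuleCat.{v} R} {hM : C M} :
    isoClass M hM = 0 ↔ Subsingleton M := by
  refine (isoClass_eq_iff (hN := hC.zero)).trans ⟨fun ⟨e⟩ => e.toEquiv.subsingleton, fun h => ?_⟩
  exact ⟨LinearEquiv.ofSubsingleton M PUnit.{v + 1}⟩

theorem isAddUnit_isoClass_iff {M : ModuleCat.{v} R} {hM : C M} :
    IsAddUnit (isoClass M hM) ↔ Subsingleton M := by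
  refine ⟨fun h => ?_, fun h => by rw [isoClass_eq_zero_iff.2 h]; exact isAddUnit_zero⟩
  obtain ⟨b, hb⟩ := isAddUnit_iff_exists_neg.1 h
  obtain ⟨N, hN, rfl⟩ := exists_eq_isoClass b
  rw [isoClass_add, isoClass_eq_zero_iff] at hb
  exact (Prod.fst_surjective (α := M) (β := N)).subsingleton

/-- Indecomposability tests all modules, irreducibility only those in `C`; closure under summands
bridges the two. -/
theorem addIrreducible_isoClass_iff {M : ModuleCat.{v} R} {hM : C M} :
    AddIrreducible (isoClass M hM) ↔ Indecomposable M := by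
  rw [addIrreducible_iff, isAddUnit_isoClass_iff, not_subsingleton_iff_nontrivial]
  refine and_congr_right fun _ => ⟨fun h N P ⟨e⟩ => ?_, fun h a b hab => ?_⟩
  · obtain ⟨hN, hP⟩ := hC.summand N P (hC.of_equiv M (ModuleCat.of R (N × P)) ⟨e⟩ hM)
    have := h (a := isoClass N hN) (b := isoClass P hP)
      ((isoClass_add hN hP).symm ▸ isoClass_eq_iff.2 ⟨e⟩)
    rwa [isAddUnit_isoClass_iff, isAddUnit_isoClass_iff] at this
  · obtain ⟨N, hN, rfl⟩ := exists_eq_isoClass a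
    obtain ⟨P, hP, rfl⟩ := exists_eq_isoClass b
    rw [isAddUnit_isoClass_iff, isAddUnit_isoClass_iff]
    exact h N P (isoClass_eq_iff.1 (hab.trans (isoClass_add hN hP)))

theorem finite_atoms_isoClasses {S : Set (ModuleCat.{v} R)} (hS : S.Finite)
    (h : ∀ M : ModuleCat.{v} R, C M → Indecomposable M → ∃ N ∈ S, Nonempty (M ≃ₗ[R] N)) :
    Finite {a : IsoClasses C // AddIrreducible a} := by
  classical
  refine Set.Finite.to_subtype (s := {a : IsoClasses C | AddIrreducible a}) ?_
  -- `S` may contain modules outside `C`; these get the dummy value 0.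
  refine (hS.image fun N => if hN : C N then isoClass N hN else 0).subset fun a ha => ?_
  obtain ⟨M, hM, rfl⟩ := exists_eq_isoClass a
  obtain ⟨N, hNS, e⟩ := h M hM (addIrreducible_isoClass_iff.1 ha)
  have hN : C N := hC.of_equiv M N e hM
  refine ⟨N, hNS, ?_⟩
  simp only [hN, dif_pos]
  exact (isoClass_eq_iff.2 e).symm

theorem isAddUnit_of_add_eq_self (h : ∀ M : ModuleCat.{v} R, C M → DirectlyFinite M)
    (a b : IsoClasses C) (hab : a + b = a) : IsAddUnit b := by
  obtain ⟨M, hM, rfl⟩ := exists_eq_isoClass a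
  obtain ⟨N, hN, rfl⟩ := exists_eq_isoClass b
  rw [isoClass_add] at hab
  exact isAddUnit_isoClass_iff.2 (h M hM N (isoClass_eq_iff.1 hab.symm))

end IsoClasses

end UnionsOfLengths

theorem mainTheorem9 {R : Type u} [Ring R] (C : ModuleCat.{v} R → Prop)
    [UnionsOfLengths.ClosedUnderSumsAndSummands C]
    (hfinite : ∀ M : ModuleCat.{v} R, C M → UnionsOfLengths.DirectlyFinite M)
    (hindec : ∃ S : Set (ModuleCat.{v} R), S.Finite ∧
      ∀ M : ModuleCat.{v} R, C M → UnionsOfLengths.Indecomposable M →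
        ∃ N ∈ S, Nonempty (M ≃ₗ[R] N))
    (hne : ∃ M : ModuleCat.{v} R, C M ∧ UnionsOfLengths.Indecomposable M) :
    UnionsOfLengths.SatisfiesStructureTheoremForUnions
      (UnionsOfLengths.systemOfSetsOfLengths (UnionsOfLengths.IsoClasses C)) := by
  obtain ⟨S, hS, h⟩ := hindec
  obtain ⟨M, hM, hMi⟩ := hne
  exact UnionsOfLengths.satisfiesStructureTheoremForUnions_of_finite_atoms
    (UnionsOfLengths.isAddUnit_of_add_eq_self hfinite)
    (UnionsOfLengths.finite_atoms_isoClasses hS h)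
    ⟨_, UnionsOfLengths.addIrreducible_isoClass_iff (hM := hM).2 hMi⟩
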